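/- Let $E$ be a finite set and let $X=(X_t)_{t\ge 0}$ be a time-homogeneous continuous-time Markov chain with values in $E$ and right-continuous paths, with laws $(\mathbb P_x)_{x\in E}$ such that $\mathbb P_x(X_0=x)=1$, and with Markov generator $\mathcal Q=(Q(x,y))_{x,y\in E}$ (so $\sum_{y}Q(x,y)=0$ for all $x$, $Q(x,y)\ge 0$ for $x\ne y$, and $Q(x,y)$ is the right derivative at $t=0$ of $t\mapsto\mathbb P_x(X_t=y)$). Stopping times are $[0,+\infty]$-valued and refer to the natural filtration $\mathcal F_t=\sigma(X_s,\,0\le s\le t)$ of $X$. Let $\beta>0$ and let $\psi,\phi:E\to\mathbb R$ satisfy $0\le\psi\le\phi$. For stopping times $\tau,\gamma$ and $x\in E$ put $$R_x(\tau,\gamma)=\mathbb E_x\big[e^{-\beta\tau}\psi(X_\tau)\mathbf 1_{\{\tau\le\gamma\}}+e^{-\beta\gamma}\phi(X_\gamma)\mathbf 1_{\{\tau>\gamma\}}\big],\qquad V_0(x)=\sup_\tau\mathbb E_x\big[e^{-\beta\tau}\psi(X_\tau)\big],$$ where $e^{-\beta\eta}f(X_\eta)=0$ on $\{\eta=+\infty\}$.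 For $A\subset E$ let $h(A)=\inf\{t\ge 0: X_t\in A\}$ (with $\inf\emptyset=+\infty$), and for functions $f,g$ on $E$ write $\{f=g\}=\{y\in E: f(y)=g(y)\}$. Then: 1. For every $x\in E$, $\mathbb P_x\big(h(\{V_0=\psi\})<+\infty\big)=1$. 2. The zero-sum stopping game with payoff $R_x$ (the first player chooses $\tau$ to maximize, the second chooses $\gamma$ to minimize) has a value, that is, for every $x\in E$, $$V(x):=\sup_\tau\inf_\gamma R_x(\tau,\gamma)=\inf_\gamma\sup_\tau R_x(\tau,\gamma),$$ and the pair $(\tau',\gamma')=\big(h(\{V=\psi\}),h(\{V=\phi\})\big)$ is a Nash equilibrium: $\tau'$ and $\gamma'$ are stopping times and $R_x(\tau,\gamma')\le R_x(\tau',\gamma')\le R_x(\tau',\gamma)$ for all $x\in E$ and all stopping times $\tau,\gamma$. Moreover, for every $x\in E$, $$\mathbb P_x\big(h(\{V=\psi\})<+\infty\big)=1;$$ in particular, the game played with the equilibrium strategies $(\tau',\gamma')$ ends in finite time: $\mathbb P_x(\tau'\wedge\gamma'<+\infty)=1$ for every $x\in E$. -/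

import Mathlib

open MeasureTheory ProbabilityTheory
open scoped NNReal ENNReal

namespace StoppingGame

/-- A Markov generator on the finite set `E`: rows sum to zero, off-diagonal entries are `≥ 0`. -/
structure IsMarkovGenerator {E : Type*} [Fintype E] (Q : Matrix E E ℝ) : Prop where
  row_sum : ∀ x, ∑ y, Q x y = 0
  offDiag_nonneg : ∀ x y, x ≠ y → 0 ≤ Q x y

/-- A time-homogeneous continuous-time Markov chain `X` on the finite (discrete) state space `E`,
defined on the measurable space `Ω`, with right-continuous paths, laws `P x` (`x` the starting
state) and Markov generator `Q`. -/
structure MarkovChain (Ω E : Type*) [MeasurableSpace Ω] [Fintype E] [TopologicalSpace E]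
    [DiscreteTopology E] [MeasurableSpace E] [BorelSpace E] (Q : Matrix E E ℝ) where
  /-- the process -/
  X : ℝ≥0 → Ω → E
  /-- the law of the chain started at a given state -/
  P : E → Measure Ω
  isMarkovGenerator : IsMarkovGenerator Q
  isProbabilityMeasure : ∀ x, IsProbabilityMeasure (P x)
  stronglyMeasurable : ∀ t, StronglyMeasurable (X t)
  right_continuous : ∀ ω t, ContinuousWithinAt (fun s => X s ω) (Set.Ici t) t
  start : ∀ x, P x {ω | X 0 ω = x} = 1
  /-- The Markov property: given the natural filtration at time `s`, the conditional probability
  of `X (s + t) = z` is `P (X s) (X t = z)`. -/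
  markov : ∀ (x : E) (s t : ℝ≥0) (z : E) (A : Set Ω),
    MeasurableSet[Filtration.natural X stronglyMeasurable s] A →
      P x (A ∩ {ω | X (s + t) ω = z}) = ∫⁻ ω in A, P (X s ω) {ω' | X t ω' = z} ∂(P x)
  /-- The generator is the right derivative at time `0` of the transition matrices
  `t ↦ (P x (X t = y))`. -/
  generator : ∀ x y : E,
    HasDerivWithinAt (fun t : ℝ => (P x).real {ω | X t.toNNReal ω = y}) (Q x y) (Set.Ici 0) 0

namespace MarkovChain

variable {Ω E : Type*} [MeasurableSpace Ω] [Fintype E] [TopologicalSpace E]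
  [DiscreteTopology E] [MeasurableSpace E] [BorelSpace E] {Q : Matrix E E ℝ}

/-- The natural filtration `σ(X s, s ≤ t)`. -/
noncomputable def filtration (M : MarkovChain Ω E Q) : Filtration ℝ≥0 ‹MeasurableSpace Ω› :=
  Filtration.natural M.X M.stronglyMeasurable

/-- The set of all `[0, ∞]`-valued stopping times of the natural filtration. -/
def StoppingTime (M : MarkovChain Ω E Q) : Type _ :=
  {τ : Ω → WithTop ℝ≥0 // IsStoppingTime M.filtration τ}

/-- The first hitting time `inf {t ≥ 0 : X t ∈ A}`, equal to `⊤` if `A` is never hit. -/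
noncomputable def h (M : MarkovChain Ω E Q) (A : Set E) : Ω → WithTop ℝ≥0 :=
  hittingAfter M.X A 0

open Classical in
/-- `exp (-β τ) f (X τ)`, equal to `0` where `τ = ∞`. -/
noncomputable def discounted (M : MarkovChain Ω E Q) (β : ℝ) (f : E → ℝ)
    (τ : Ω → WithTop ℝ≥0) (ω : Ω) : ℝ :=
  if τ ω = ⊤ then 0
  else Real.exp (-β * ((τ ω).untopD 0 : ℝ≥0)) * f (M.X ((τ ω).untopD 0) ω)

open Classical in
/-- The expected payoff
`R_x(τ, γ) = E_x [exp (-β τ) ψ(X τ) 1_{τ ≤ γ} + exp (-β γ) φ(X γ) 1_{γ < τ}]`. -/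
noncomputable def payoff (M : MarkovChain Ω E Q) (β : ℝ) (ψ φ : E → ℝ) (x : E)
    (τ γ : Ω → WithTop ℝ≥0) : ℝ :=
  ∫ ω, (if τ ω ≤ γ ω then M.discounted β ψ τ ω else M.discounted β φ γ ω) ∂(M.P x)

/-- The value function `V₀` of the one-player stopping problem with reward `ψ`. -/
noncomputable def V₀ (M : MarkovChain Ω E Q) (β : ℝ) (ψ : E → ℝ) (x : E) : ℝ :=
  ⨆ τ : M.StoppingTime, ∫ ω, M.discounted β ψ τ.1 ω ∂(M.P x)

/-- The upper value `inf_γ sup_τ R_x(τ, γ)`. -/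
noncomputable def upperValue (M : MarkovChain Ω E Q) (β : ℝ) (ψ φ : E → ℝ) (x : E) : ℝ :=
  ⨅ γ : M.StoppingTime, ⨆ τ : M.StoppingTime, M.payoff β ψ φ x τ.1 γ.1

/-- The lower value `sup_τ inf_γ R_x(τ, γ)`. -/
noncomputable def lowerValue (M : MarkovChain Ω E Q) (β : ℝ) (ψ φ : E → ℝ) (x : E) : ℝ :=
  ⨆ τ : M.StoppingTime, ⨅ γ : M.StoppingTime, M.payoff β ψ φ x τ.1 γ.1

/-- `V` is the value function of the game: the upper and lower values agree and equal `V`. -/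
def IsValue (M : MarkovChain Ω E Q) (β : ℝ) (ψ φ V : E → ℝ) : Prop :=
  ∀ x, M.lowerValue β ψ φ x = V x ∧ M.upperValue β ψ φ x = V x

/-- `(τ', γ')` is a Nash equilibrium (saddle point) of the game, for every starting state. -/
structure IsNash (M : MarkovChain Ω E Q) (β : ℝ) (ψ φ : E → ℝ)
    (τ' γ' : Ω → WithTop ℝ≥0) : Prop where
  isStoppingTime_fst : IsStoppingTime M.filtration τ'
  isStoppingTime_snd : IsStoppingTime M.filtration γ'
  le : ∀ (x : E) (τ : M.StoppingTime), M.payoff β ψ φ x τ.1 γ' ≤ M.payoff β ψ φ x τ' γ'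
  ge : ∀ (x : E) (γ : M.StoppingTime), M.payoff β ψ φ x τ' γ' ≤ M.payoff β ψ φ x τ' γ.1

end MarkovChain

end StoppingGame

open Filter Topology

namespace StoppingGame

/-! The value is constructed analytically and then verified. Uniformization turns the double
obstacle problem into a fixed-point equation for a contraction (`exists_obstacle_solution`). Its
solution satisfies `ψ ≤ V ≤ φ`, with `(𝒬 - β) V ≤ 0` off `{V = φ}` and `(𝒬 - β) V ≥ 0` off `{V =
ψ}`.

Dynkin inequalities for the discounted process `V(X)`, stopped at `τ ∧ γ'` or `τ' ∧ γ`, then give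
`R(τ, γ') ≤ V ≤ R(τ', γ)`, which is a saddle point. They are derived from the Markov property on
time grids (`le_integral_gridStopped`) and a limit by right continuity (`le_integral_discounted`),
without the jump structure of the chain.

Finiteness needs no irreducibility. Off `{V = ψ}` one has `V ≥ m > 0`, hence `𝒬 V ≥ β V ≥ β m`; a
bounded function cannot grow in mean at a positive rate forever (`measure_lt_top_eq_one`). The same
argument applies to `V₀`, identified with the solution of the one-obstacle problem (`V₀_obstacle`).
-/

/-! ### Obstacle problems for the generator. -/

/-- The operator `𝒬 - β`, acting on functions on the state space. -/
def discountedGenerator {E : Type*} [Fintype E] (Q : Matrix E E ℝ) (β : ℝ) (f : E → ℝ) (x : E) :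
    ℝ :=
  ∑ y, Q x y * f y - β * f x

lemma discountedGenerator_neg {E : Type*} [Fintype E] (Q : Matrix E E ℝ) (β : ℝ) (f : E → ℝ)
    (x : E) : discountedGenerator Q β (fun y => -f y) x = -discountedGenerator Q β f x := by
  simp [discountedGenerator]
  ring

/-- Solvability of nonlinear obstacle problems by Banach's fixed point theorem for the
uniformized chain. -/
lemma exists_obstacle_solution {E : Type*} [Fintype E] {Q : Matrix E E ℝ}
    (hQ : IsMarkovGenerator Q) {β : ℝ} (hβ : 0 < β) (c : E → ℝ → ℝ)
    (hc : ∀ x u v, |c x u - c x v| ≤ |u - v|) :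
    ∃ (V : E → ℝ) (a : ℝ), 0 < a ∧ ∀ x, V x = c x (V x + a * discountedGenerator Q β V x) := by
  classical
  obtain ⟨l, hl0, hl⟩ : ∃ l : ℝ, 0 ≤ l ∧ ∀ x, -Q x x ≤ l :=
    ⟨∑ x, |Q x x|, Finset.sum_nonneg fun _ _ => abs_nonneg _, fun x =>
      (neg_le_abs _).trans (Finset.single_le_sum (f := fun x => |Q x x|)
        (fun _ _ => abs_nonneg _) (Finset.mem_univ x))⟩
  have hlβ : 0 < l + β := by linarith
  -- `T` is the matrix `(Q + l) / (l + β)`: its entries are nonnegative and its rows sum to `l / (l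
  -- + β) < 1`.
  let T : (E → ℝ) → E → ℝ := fun V x => V x + (l + β)⁻¹ * discountedGenerator Q β V x
  have hT : ∀ V W x, |T V x - T W x| ≤ l / (l + β) * dist V W := by
    intro V W x
    have h1 : T V x - T W x
        = (l + β)⁻¹ * ∑ y, (Q x y + if x = y then l else 0) * (V y - W y) := by
      simp only [T, discountedGenerator, add_mul, Finset.sum_add_distrib, mul_sub, ite_mul,
        zero_mul, Finset.sum_sub_distrib, Finset.sum_ite_eq, Finset.mem_univ, if_true]
      field_simp
      ring
    have hnn : ∀ y, 0 ≤ Q x y + if x = y then l else 0 := by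
      intro y
      split_ifs with h
      · subst h; linarith [hl x]
      · simpa using hQ.offDiag_nonneg x y h
    have h2 : |∑ y, (Q x y + if x = y then l else 0) * (V y - W y)| ≤ l * dist V W := by
      calc _ ≤ ∑ y, |(Q x y + if x = y then l else 0) * (V y - W y)| :=
            Finset.abs_sum_le_sum_abs _ _
        _ ≤ ∑ y, (Q x y + if x = y then l else 0) * dist V W := by
            refine Finset.sum_le_sum fun y _ => ?_
            rw [abs_mul, abs_of_nonneg (hnn y)]
            exact mul_le_mul_of_nonneg_left (dist_le_pi_dist V W y) (hnn y)
        _ = l * dist V W := by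
            rw [← Finset.sum_mul, Finset.sum_add_distrib, hQ.row_sum]
            simp
    rw [h1, abs_mul, abs_of_pos (inv_pos.2 hlβ), div_eq_inv_mul, mul_assoc]
    exact mul_le_mul_of_nonneg_left h2 (inv_pos.2 hlβ).le
  let F : (E → ℝ) → E → ℝ := fun V x => c x (T V x)
  have hF : ContractingWith (l / (l + β)).toNNReal F := by
    have h0 : 0 ≤ l / (l + β) := div_nonneg hl0 hlβ.le
    refine ⟨?_, LipschitzWith.of_dist_le_mul fun V W => ?_⟩
    · rw [Real.toNNReal_lt_one, div_lt_one hlβ]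
      linarith
    · rw [Real.coe_toNNReal _ h0]
      exact (dist_pi_le_iff (mul_nonneg h0 dist_nonneg)).2 fun x =>
        (hc x _ _).trans (hT V W x)
  exact ⟨_, (l + β)⁻¹, inv_pos.2 hlβ, fun x => (congrFun hF.fixedPoint_isFixedPt x).symm⟩

lemma exists_abs_le {E : Type*} [Fintype E] (f : E → ℝ) : ∃ C, 0 ≤ C ∧ ∀ x, |f x| ≤ C :=
  ⟨∑ x, |f x|, Finset.sum_nonneg fun _ _ => abs_nonneg _, fun x =>
    Finset.single_le_sum (f := fun x => |f x|) (fun _ _ => abs_nonneg _) (Finset.mem_univ x)⟩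

namespace MarkovChain

variable {Ω E : Type*} [MeasurableSpace Ω] [Fintype E] [TopologicalSpace E]
  [DiscreteTopology E] [MeasurableSpace E] [BorelSpace E] {Q : Matrix E E ℝ}
  (M : MarkovChain Ω E Q)

/-! ### Measurability, Markov property and short-time expansion. -/

instance (x : E) : IsProbabilityMeasure (M.P x) := M.isProbabilityMeasure x

lemma measurable_X (t : ℝ≥0) : Measurable (M.X t) := (M.stronglyMeasurable t).measurable

lemma measurable_X_filtration {s t : ℝ≥0} (h : s ≤ t) : Measurable[M.filtration t] (M.X s) :=
  measurable_iff_comap_le.2 <| le_iSup₂_of_le (f := fun j (_ : j ≤ t) =>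
    MeasurableSpace.comap (M.X j) _) s h le_rfl

lemma measurable_comp_X (f : E → ℝ) (t : ℝ≥0) : Measurable fun ω => f (M.X t ω) :=
  (measurable_of_countable f).comp (M.measurable_X t)

lemma measurableSet_X_eq (t : ℝ≥0) (z : E) : MeasurableSet {ω | M.X t ω = z} :=
  M.measurable_X t (measurableSet_singleton z)

lemma integrable_comp_X (x : E) (f : E → ℝ) (t : ℝ≥0) :
    Integrable (fun ω => f (M.X t ω)) (M.P x) := by
  obtain ⟨C, -, hC⟩ := exists_abs_le f
  exact Integrable.of_bound (M.measurable_comp_X f t).aestronglyMeasurable C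
    (ae_of_all _ fun ω => hC _)

lemma integral_comp_X_zero (x : E) (f : E → ℝ) : ∫ ω, f (M.X 0 ω) ∂(M.P x) = f x := by
  have h : ∀ᵐ ω ∂(M.P x), M.X 0 ω = x :=
    (mem_ae_iff_prob_eq_one (M.measurableSet_X_eq 0 x)).2 (M.start x)
  rw [integral_congr_ae (g := fun _ => f x) (h.mono fun ω hω => by simp only [hω])]
  simp

/-- The transition semigroup. -/
noncomputable def semigroup (t : ℝ≥0) (f : E → ℝ) (x : E) : ℝ :=
  ∑ z, f z * (M.P x).real {ω | M.X t ω = z}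

/-- The Markov property, given for single states, extends to `f` by linearity, since `f` is a finite
combination of indicators. -/
lemma setIntegral_comp_X_add (x : E) (f : E → ℝ) (s t : ℝ≥0) {A : Set Ω}
    (hA : MeasurableSet[M.filtration s] A) :
    ∫ ω in A, f (M.X (s + t) ω) ∂(M.P x) = ∫ ω in A, M.semigroup t f (M.X s ω) ∂(M.P x) := by
  classical
  have hA' : MeasurableSet A := M.filtration.le s _ hA
  have h1 : ∀ ω, f (M.X (s + t) ω)
      = ∑ z, f z * Set.indicator {ω | M.X (s + t) ω = z} 1 ω := by
    intro ω
    simp [Set.indicator_apply]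
  have h2 : ∀ z, ∫ ω in A, (M.P (M.X s ω)).real {ω' | M.X t ω' = z} ∂(M.P x)
      = (M.P x).real (A ∩ {ω | M.X (s + t) ω = z}) := by
    intro z
    rw [measureReal_def, M.markov x s t z A hA]
    refine integral_toReal ?_ (ae_of_all _ fun ω => measure_lt_top _ _)
    exact ((measurable_of_countable fun y => M.P y {ω' | M.X t ω' = z}).comp
      (M.measurable_X s)).aemeasurable
  have hi : ∀ z, Integrable (fun ω => (M.P (M.X s ω)).real {ω' | M.X t ω' = z})
      ((M.P x).restrict A) := fun z =>
    (M.integrable_comp_X x (fun y => (M.P y).real {ω' | M.X t ω' = z}) s).integrableOn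
  simp_rw [h1, semigroup]
  rw [integral_finsetSum _ fun z _ => ?_, integral_finsetSum _ fun z _ => (hi z).const_mul _]
  · refine Finset.sum_congr rfl fun z _ => ?_
    rw [integral_const_mul, integral_const_mul, h2,
      integral_indicator_one (M.measurableSet_X_eq _ z),
      measureReal_restrict_apply (M.measurableSet_X_eq _ z), Set.inter_comm]
  · exact ((integrable_indicator_iff (M.measurableSet_X_eq _ z)).2
      (integrable_const (1 : ℝ)).integrableOn).const_mul _

/-- Short-time expansion of the discounted transition semigroup. -/
lemma exists_semigroup_lower_bound (β : ℝ) (f : E → ℝ) {ε : ℝ} (hε : 0 < ε) :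
    ∃ δ₀ > (0 : ℝ), ∀ δ : ℝ≥0, δ < δ₀ → ∀ y,
      δ * (discountedGenerator Q β f y - ε) ≤ Real.exp (-β * δ) * M.semigroup δ f y - f y := by
  classical
  have hev : ∀ y, ∀ᶠ t : ℝ in 𝓝[Set.Ici 0] 0, t * (discountedGenerator Q β f y - ε) ≤
      Real.exp (-β * t) * M.semigroup t.toNNReal f y - f y := by
    intro y
    have h0 : M.semigroup (0 : ℝ).toNNReal f y = f y := by
      have hp : ∀ z, (M.P y).real {ω | M.X 0 ω = z} = if z = y then 1 else 0 := by
        intro z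
        split_ifs with h
        · subst h; simp [measureReal_def, M.start]
        · rw [measureReal_def]
          have : ∀ᵐ ω ∂(M.P y), M.X 0 ω = y :=
            (mem_ae_iff_prob_eq_one (M.measurableSet_X_eq 0 y)).2 (M.start y)
          have h' : M.P y {ω | M.X 0 ω = z} = 0 :=
            measure_mono_null (fun ω (hω : M.X 0 ω = z) => by
              show M.X 0 ω ≠ y
              exact fun h'' => h (hω.symm.trans h'')) this
          simp [h']
      simp [semigroup, hp]
    have hd : HasDerivWithinAt (fun t : ℝ => M.semigroup t.toNNReal f y) (∑ z, f z * Q y z)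
        (Set.Ici 0) 0 := by
      unfold semigroup
      exact HasDerivWithinAt.fun_sum fun z _ => (M.generator y z).const_mul (f z)
    have he : HasDerivWithinAt (fun t : ℝ => Real.exp (-β * t)) (-β) (Set.Ici 0) 0 := by
      have := ((hasDerivAt_id (0 : ℝ)).const_mul (-β)).exp
      simpa using this.hasDerivWithinAt
    have hm := he.mul hd
    have hderiv : -β * M.semigroup (0 : ℝ).toNNReal f y
        + Real.exp (-β * 0) * ∑ z, f z * Q y z = discountedGenerator Q β f y := by
      rw [h0, discountedGenerator]
      simp [mul_comm]
      ring
    rw [hderiv] at hm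
    have ho := (hasDerivWithinAt_iff_isLittleO.1 hm).def hε
    filter_upwards [ho, self_mem_nhdsWithin] with t ht ht0
    have ht0' : (0 : ℝ) ≤ t := ht0
    simp only [Pi.mul_apply, h0, sub_zero, smul_eq_mul, Real.norm_eq_abs, abs_of_nonneg ht0',
      mul_zero, Real.exp_zero, one_mul] at ht
    have := (abs_le.1 ht).1
    nlinarith
  -- Finiteness of `E` makes the expansion uniform in the starting state.
  obtain ⟨δ₀, h0, h⟩ := Metric.mem_nhdsWithin_iff.1 (eventually_all.2 hev)
  refine ⟨δ₀, h0, fun δ hδ => ?_⟩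
  have := h (show (δ : ℝ) ∈ _ from ⟨by simpa using hδ, δ.2⟩)
  simpa using this

/-! ### Dynkin's formula on a time grid. -/

open Classical in
/-- The discounted process `exp (-β t) f (X t)`, stopped at the first point of the grid
`{0, δ, …, K δ}` that is not smaller than `σ` (at `K δ` if there is none), written as a
telescoping sum. -/
noncomputable def gridStopped (β : ℝ) (f : E → ℝ) (δ : ℝ≥0) (σ : Ω → WithTop ℝ≥0) (K : ℕ)
    (ω : Ω) : ℝ :=
  f (M.X 0 ω) + ∑ k ∈ Finset.range K, if (((k : ℝ≥0) * δ : ℝ≥0) : WithTop ℝ≥0) < σ ω then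
    Real.exp (-β * (k * δ)) * (Real.exp (-β * δ) * f (M.X (k * δ + δ) ω) - f (M.X (k * δ) ω))
    else 0

lemma measurableSet_lt {σ : Ω → WithTop ℝ≥0} (hσ : IsStoppingTime M.filtration σ) (t : ℝ≥0) :
    MeasurableSet[M.filtration t] {ω | (t : WithTop ℝ≥0) < σ ω} := by
  simpa using hσ.measurableSet_gt t

lemma measurable_gridStopped (β : ℝ) (f : E → ℝ) (δ : ℝ≥0) {σ : Ω → WithTop ℝ≥0}
    (hσ : IsStoppingTime M.filtration σ) (K : ℕ) : Measurable (M.gridStopped β f δ σ K) := by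
  refine (M.measurable_comp_X f 0).add (Finset.measurable_fun_sum _ fun k _ => ?_)
  exact Measurable.ite (M.filtration.le _ _ (M.measurableSet_lt hσ _))
    ((((M.measurable_comp_X f _).const_mul _).sub (M.measurable_comp_X f _)).const_mul _)
    measurable_const

/-- The summands with `k * δ < σ` form an initial segment, so the sum telescopes to one value at the
index `m` where the segment ends. Bounds and limits are read off from this form. -/
lemma gridStopped_eq (β : ℝ) (f : E → ℝ) (δ : ℝ≥0) (σ : Ω → WithTop ℝ≥0) (K : ℕ) (ω : Ω) :
    ∃ m ≤ K, M.gridStopped β f δ σ K ω = Real.exp (-β * (m * δ)) * f (M.X (m * δ) ω) ∧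
      (∀ k < m, (((k : ℝ≥0) * δ : ℝ≥0) : WithTop ℝ≥0) < σ ω) ∧
      (m < K → σ ω ≤ (((m : ℝ≥0) * δ : ℝ≥0) : WithTop ℝ≥0)) := by
  induction K with
  | zero => exact ⟨0, le_rfl, by simp [gridStopped], by simp, by simp⟩
  | succ K ih =>
    obtain ⟨m, hmK, heq, hlt, hle⟩ := ih
    have hsucc : M.gridStopped β f δ σ (K + 1) ω = M.gridStopped β f δ σ K ω +
        if (((K : ℝ≥0) * δ : ℝ≥0) : WithTop ℝ≥0) < σ ω then
          Real.exp (-β * (K * δ)) *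
            (Real.exp (-β * δ) * f (M.X (K * δ + δ) ω) - f (M.X (K * δ) ω)) else 0 := by
      simp only [gridStopped, Finset.sum_range_succ, add_assoc]
    by_cases hK : (((K : ℝ≥0) * δ : ℝ≥0) : WithTop ℝ≥0) < σ ω
    · obtain rfl : m = K := by
        by_contra hne
        have hmK' := lt_of_le_of_ne hmK hne
        refine absurd (hK.trans_le (hle hmK')) (not_lt.2 ?_)
        have : (m : ℝ≥0) ≤ K := by exact_mod_cast hmK
        exact WithTop.coe_le_coe.2 (by gcongr)
      refine ⟨m + 1, le_rfl, ?_, ?_, fun h => absurd h (lt_irrefl _)⟩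
      · rw [hsucc, heq, if_pos hK]
        have h1 : ((m + 1 : ℕ) : ℝ≥0) * δ = m * δ + δ := by push_cast; ring
        have h2 : -β * (((m + 1 : ℕ) : ℝ) * (δ : ℝ)) = -β * (m * δ) + -β * δ := by
          push_cast; ring
        rw [h1, h2, Real.exp_add]
        ring
      · intro k hk
        rcases Nat.lt_succ_iff_lt_or_eq.1 hk with h | rfl
        · exact hlt k h
        · exact hK
    · refine ⟨m, hmK.trans (Nat.le_succ _), ?_, hlt, fun _ => ?_⟩
      · rw [hsucc, heq, if_neg hK, add_zero]
      · rcases hmK.lt_or_eq with h | rfl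
        · exact hle h
        · exact not_lt.1 hK

lemma abs_gridStopped_le {β : ℝ} (hβ : 0 ≤ β) {f : E → ℝ} {C : ℝ} (hC : ∀ x, |f x| ≤ C)
    (δ : ℝ≥0) (σ : Ω → WithTop ℝ≥0) (K : ℕ) (ω : Ω) : |M.gridStopped β f δ σ K ω| ≤ C := by
  obtain ⟨m, -, heq, -⟩ := M.gridStopped_eq β f δ σ K ω
  rw [heq, abs_mul, Real.abs_exp]
  have h1 : Real.exp (-β * (m * δ)) ≤ 1 := Real.exp_le_one_iff.2 (by
    have : 0 ≤ β * (m * δ) := by positivity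
    linarith)
  have h2 := hC (M.X (m * δ) ω)
  nlinarith [abs_nonneg (f (M.X (m * δ) ω)), Real.exp_pos (-β * (m * δ))]

/-- Dynkin's formula on a grid, as an inequality. -/
lemma le_integral_gridStopped (β : ℝ) (f : E → ℝ) (δ : ℝ≥0) {σ : Ω → WithTop ℝ≥0}
    (hσ : IsStoppingTime M.filtration σ) (x : E) {a : ℝ}
    (ha : ∀ ω (s : ℝ≥0), (s : WithTop ℝ≥0) < σ ω →
      a ≤ Real.exp (-β * δ) * M.semigroup δ f (M.X s ω) - f (M.X s ω)) (K : ℕ) :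
    f x + ∑ k ∈ Finset.range K, Real.exp (-β * (k * δ)) *
        (a * (M.P x).real {ω | (((k : ℝ≥0) * δ : ℝ≥0) : WithTop ℝ≥0) < σ ω})
      ≤ ∫ ω, M.gridStopped β f δ σ K ω ∂(M.P x) := by
  classical
  have key : ∀ k : ℕ, Integrable (fun ω => if (((k : ℝ≥0) * δ : ℝ≥0) : WithTop ℝ≥0) < σ ω then
      Real.exp (-β * (k * δ)) * (Real.exp (-β * δ) * f (M.X (k * δ + δ) ω) - f (M.X (k * δ) ω))
      else 0) (M.P x) ∧
      Real.exp (-β * (k * δ)) *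
        (a * (M.P x).real {ω | (((k : ℝ≥0) * δ : ℝ≥0) : WithTop ℝ≥0) < σ ω})
      ≤ ∫ ω, (if (((k : ℝ≥0) * δ : ℝ≥0) : WithTop ℝ≥0) < σ ω then
      Real.exp (-β * (k * δ)) * (Real.exp (-β * δ) * f (M.X (k * δ + δ) ω) - f (M.X (k * δ) ω))
      else 0) ∂(M.P x) := by
    intro k
    set t : ℝ≥0 := k * δ with ht
    set A : Set Ω := {ω | (t : WithTop ℝ≥0) < σ ω} with hAdef
    have hA : MeasurableSet[M.filtration t] A := M.measurableSet_lt hσ t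
    have hA' : MeasurableSet A := M.filtration.le _ _ hA
    have hind : (fun ω => if (t : WithTop ℝ≥0) < σ ω then
        Real.exp (-β * (k * δ)) * (Real.exp (-β * δ) * f (M.X (t + δ) ω) - f (M.X t ω))
        else 0) = A.indicator (fun ω =>
        Real.exp (-β * (k * δ)) * (Real.exp (-β * δ) * f (M.X (t + δ) ω) - f (M.X t ω))) := by
      ext ω
      simp [Set.indicator_apply, hAdef]
    have hI1 := (M.integrable_comp_X x f (t + δ)).const_mul (Real.exp (-β * δ))
    have hI2 := M.integrable_comp_X x f t
    have hI3 := (M.integrable_comp_X x (M.semigroup δ f) t).const_mul (Real.exp (-β * δ))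
    have hI := (hI1.sub hI2).const_mul (Real.exp (-β * (k * δ)))
    refine ⟨by rw [hind]; exact hI.indicator hA', ?_⟩
    rw [hind, integral_indicator hA', integral_const_mul]
    refine mul_le_mul_of_nonneg_left ?_ (Real.exp_pos _).le
    -- Since `{t < σ}` lies in the filtration at time `t`, the Markov property applies on it.
    rw [integral_sub hI1.integrableOn hI2.integrableOn, integral_const_mul,
      M.setIntegral_comp_X_add x f t δ hA, ← integral_const_mul,
      ← integral_sub hI3.integrableOn hI2.integrableOn]
    calc a * (M.P x).real A = ∫ ω in A, a ∂(M.P x) := by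
          simp [mul_comm]
      _ ≤ _ := setIntegral_mono_on (integrable_const a).integrableOn
          (hI3.sub hI2).integrableOn hA' fun ω hω => ha ω t hω
  unfold gridStopped
  rw [integral_add (M.integrable_comp_X x f 0) (integrable_finsetSum _ fun k _ => (key k).1),
    M.integral_comp_X_zero, integral_finsetSum _ fun k _ => (key k).1]
  gcongr with k hk
  exact (key k).2

/-! ### Almost sure finiteness from positive drift. -/

/-- If `𝒬 W` is bounded below by a positive constant along the path up to the stopping time `σ`,
then `σ` is finite almost surely. -/
lemma measure_lt_top_eq_one {σ : Ω → WithTop ℝ≥0} (hσ : IsStoppingTime M.filtration σ)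
    (W : E → ℝ) {c : ℝ} (hc : 0 < c)
    (h : ∀ ω (s : ℝ≥0), (s : WithTop ℝ≥0) < σ ω → c ≤ ∑ y, Q (M.X s ω) y * W y) (x : E) :
    M.P x {ω | σ ω < ⊤} = 1 := by
  obtain ⟨C, hC0, hC⟩ := exists_abs_le W
  -- Without discounting (`β = 0`), each grid step before `σ` gains at least `δ * (c / 2)` in mean;
  -- the other half of `c` absorbs the expansion error.
  obtain ⟨δ₀, hδ₀, hδ⟩ := M.exists_semigroup_lower_bound 0 W (half_pos hc)
  set δ : ℝ≥0 := (δ₀ / 2).toNNReal with hδdef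
  have hδr : (δ : ℝ) = δ₀ / 2 := Real.coe_toNNReal _ (by linarith)
  have hδ' := hδ δ (by rw [hδr]; linarith)
  set q := (M.P x).real {ω | σ ω = ⊤} with hq
  have hq0 : 0 ≤ q := measureReal_nonneg
  -- On `{σ = ⊤}` all `K` steps are made, while the stopped process and the initial value are
  -- bounded by `C`. Letting `K` grow forces `q = 0`.
  have hK : ∀ K : ℕ, K * (δ * (c / 2) * q) ≤ C + C := by
    intro K
    have h1 := M.le_integral_gridStopped 0 W δ hσ x (a := δ * (c / 2)) (fun ω s hs => by
      refine le_trans ?_ (hδ' (M.X s ω))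
      have := h ω s hs
      refine mul_le_mul_of_nonneg_left ?_ δ.2
      simp only [discountedGenerator]
      linarith) K
    have h2 : ∫ ω, M.gridStopped 0 W δ σ K ω ∂(M.P x) ≤ C := by
      have := norm_integral_le_of_norm_le_const (μ := M.P x) (C := C)
        (f := M.gridStopped 0 W δ σ K)
        (ae_of_all _ fun ω => M.abs_gridStopped_le le_rfl hC δ σ K ω)
      simp only [probReal_univ, mul_one] at this
      exact (le_abs_self _).trans this
    have h3 : K * (δ * (c / 2) * q) ≤ ∑ k ∈ Finset.range K, Real.exp (-0 * (k * δ)) *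
        (δ * (c / 2) * (M.P x).real {ω | (((k : ℝ≥0) * δ : ℝ≥0) : WithTop ℝ≥0) < σ ω}) := by
      rw [← nsmul_eq_mul]
      conv_lhs => rw [← Finset.card_range K]
      refine Finset.card_nsmul_le_sum _ _ _ fun k _ => ?_
      simp only [neg_zero, zero_mul, Real.exp_zero, one_mul]
      refine mul_le_mul_of_nonneg_left (measureReal_mono fun ω hω => ?_) (by positivity)
      show _ < σ ω
      rw [show σ ω = ⊤ from hω]
      exact WithTop.coe_lt_top _
    have := (abs_le.1 (hC x)).1
    linarith
  have hq' : q = 0 := by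
    by_contra hne
    have hpos : 0 < δ * (c / 2) * q := by
      have : 0 < q := lt_of_le_of_ne hq0 (Ne.symm hne)
      have : (0 : ℝ) < δ := by rw [hδr]; linarith
      positivity
    obtain ⟨K, hK'⟩ := exists_nat_gt ((C + C) / (δ * (c / 2) * q))
    rw [div_lt_iff₀ hpos] at hK'
    exact absurd (hK K) (not_le.2 hK')
  have h0 : M.P x {ω | σ ω = ⊤} = 0 := (measureReal_eq_zero_iff).1 hq'
  have hae : ∀ᵐ ω ∂(M.P x), σ ω < ⊤ :=
    (ae_iff (p := fun ω => σ ω < ⊤)).2 (by simpa using h0)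
  rw [measure_congr (eventuallyEq_univ.2 hae : {ω | σ ω < ⊤} =ᵐ[M.P x] Set.univ), measure_univ]

/-! ### Discounted rewards at stopping times, as limits of grids. -/

lemma discounted_of_eq_coe (β : ℝ) (f : E → ℝ) {τ : Ω → WithTop ℝ≥0} {ω : Ω} {t : ℝ≥0}
    (h : τ ω = t) : M.discounted β f τ ω = Real.exp (-β * t) * f (M.X t ω) := by
  rw [discounted, h, if_neg WithTop.coe_ne_top, WithTop.untopD_coe]

lemma discounted_of_eq_top (β : ℝ) (f : E → ℝ) {τ : Ω → WithTop ℝ≥0} {ω : Ω}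
    (h : τ ω = ⊤) : M.discounted β f τ ω = 0 := by
  simp [discounted, h]

lemma discounted_congr_time (β : ℝ) (f : E → ℝ) {τ σ : Ω → WithTop ℝ≥0} {ω : Ω}
    (h : τ ω = σ ω) : M.discounted β f τ ω = M.discounted β f σ ω := by
  simp only [discounted, h]

lemma abs_discounted_le {β : ℝ} (hβ : 0 ≤ β) {f : E → ℝ} {C : ℝ} (hC0 : 0 ≤ C)
    (hC : ∀ x, |f x| ≤ C) (τ : Ω → WithTop ℝ≥0) (ω : Ω) : |M.discounted β f τ ω| ≤ C := by
  rcases h : τ ω with _ | t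
  · rw [M.discounted_of_eq_top β f h, abs_zero]
    exact hC0
  · rw [M.discounted_of_eq_coe β f h, abs_mul, Real.abs_exp]
    have h1 : Real.exp (-β * t) ≤ 1 := Real.exp_le_one_iff.2 (by
      have : 0 ≤ β * t := by positivity
      linarith)
    have h2 := hC (M.X t ω)
    nlinarith [abs_nonneg (f (M.X t ω)), Real.exp_pos (-β * t)]

/-- On grids with mesh `1 / (n + 1)` and horizon `n + 1`, the stopped discounted process converges
to its value at the stopping time. -/
lemma tendsto_gridStopped {β : ℝ} (hβ : 0 < β) (f : E → ℝ) (σ : Ω → WithTop ℝ≥0) (ω : Ω) :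
    Tendsto (fun n : ℕ => M.gridStopped β f ((n : ℝ≥0) + 1)⁻¹ σ ((n + 1) ^ 2) ω) atTop
      (𝓝 (M.discounted β f σ ω)) := by
  choose m hmK heq hlt hle using
    fun n : ℕ => M.gridStopped_eq β f ((n : ℝ≥0) + 1)⁻¹ σ ((n + 1) ^ 2) ω
  simp only [heq]
  rcases hs : σ ω with _ | s
  -- If `σ` is infinite, the grid runs to its horizon `(n + 1) ^ 2 / (n + 1) = n + 1`, and
  -- discounting sends the term to `0`.
  · have hm : ∀ n, m n = (n + 1) ^ 2 := fun n => by
      by_contra hne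
      exact absurd (hle n (lt_of_le_of_ne (hmK n) hne)) (by
        rw [hs]; exact not_le.2 (WithTop.coe_lt_top _))
    obtain ⟨C, -, hC⟩ := exists_abs_le f
    rw [M.discounted_of_eq_top β f hs]
    have hexp : Tendsto (fun n : ℕ => Real.exp (-β * ((n : ℝ) + 1)) * C) atTop (𝓝 0) := by
      rw [← zero_mul C]
      refine Tendsto.mul_const _ (Real.tendsto_exp_atBot.comp ?_)
      exact (tendsto_atTop_add_const_right _ _ tendsto_natCast_atTop_atTop).const_mul_atTop_of_neg
        (neg_lt_zero.2 hβ)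
    refine squeeze_zero_norm (fun n => ?_) hexp
    have ht : (m n : ℝ) * (((n : ℝ≥0) + 1)⁻¹ : ℝ≥0) = (n : ℝ) + 1 := by
      rw [hm n]
      push_cast
      field_simp
    rw [Real.norm_eq_abs, abs_mul, Real.abs_exp, ht]
    exact mul_le_mul_of_nonneg_left (hC _) (Real.exp_pos _).le
  · rw [M.discounted_of_eq_coe β f hs]
    have hev : ∀ᶠ n : ℕ in atTop, s ≤ (m n : ℝ≥0) * ((n : ℝ≥0) + 1)⁻¹ ∧
        (m n : ℝ≥0) * ((n : ℝ≥0) + 1)⁻¹ ≤ s + ((n : ℝ≥0) + 1)⁻¹ := by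
      obtain ⟨N, hN⟩ := exists_nat_ge s
      -- This gives both `n ≥ s` and `n ≥ 1`: the mesh is below `1`, so the horizon `n + 1` exceeds
      -- `s` plus one mesh and the grid stops strictly before it.
      filter_upwards [eventually_ge_atTop (N + 1)] with n hn
      have hpos : (0 : ℝ≥0) < (n : ℝ≥0) + 1 := by positivity
      have hup : (m n : ℝ≥0) * ((n : ℝ≥0) + 1)⁻¹ ≤ s + ((n : ℝ≥0) + 1)⁻¹ := by
        rcases Nat.eq_zero_or_pos (m n) with h0 | h0
        · simp [h0]
        · have h1 := hlt n (m n - 1) (Nat.sub_lt h0 one_pos)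
          rw [hs] at h1
          have h2 := (WithTop.coe_lt_coe.1 h1).le
          have h3 : ((m n : ℕ) : ℝ≥0) = ((m n - 1 : ℕ) : ℝ≥0) + 1 := by
            exact_mod_cast (Nat.sub_add_cancel h0).symm
          rw [h3, add_mul, one_mul]
          gcongr
      refine ⟨?_, hup⟩
      have hm : m n < (n + 1) ^ 2 := by
        refine lt_of_le_of_ne (hmK n) fun h => ?_
        rw [h] at hup
        have h4 : (((n + 1) ^ 2 : ℕ) : ℝ≥0) * ((n : ℝ≥0) + 1)⁻¹ = (n : ℝ≥0) + 1 := by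
          push_cast
          field_simp
        rw [h4] at hup
        have h5 : ((n : ℝ≥0) + 1)⁻¹ < 1 := by
          apply inv_lt_one_of_one_lt₀
          have : (0 : ℝ≥0) < n := by exact_mod_cast (by omega : 0 < n)
          exact lt_add_of_pos_left _ this
        have h6 : s + 1 ≤ (n : ℝ≥0) + 1 := by
          gcongr
          exact hN.trans (by exact_mod_cast (by omega : N ≤ n))
        exact absurd (hup.trans_lt (add_lt_add_right h5 s)) (not_lt.2 h6)
      have := hle n hm
      rw [hs] at this
      exact WithTop.coe_le_coe.1 this
    have hδ : Tendsto (fun n : ℕ => s + ((n : ℝ≥0) + 1)⁻¹) atTop (𝓝 s) := by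
      have h1 : Tendsto (fun n : ℕ => ((n : ℝ≥0) + 1)⁻¹) atTop (𝓝 0) := by
        rw [← NNReal.tendsto_coe]
        simpa using tendsto_one_div_add_atTop_nhds_zero_nat (𝕜 := ℝ)
      simpa using tendsto_const_nhds.add h1
    -- The grid times approach `s` from the right, the only side on which paths are continuous.
    have ht : Tendsto (fun n : ℕ => (m n : ℝ≥0) * ((n : ℝ≥0) + 1)⁻¹) atTop
        (𝓝[Set.Ici s] s) := by
      refine tendsto_nhdsWithin_iff.2 ⟨?_, hev.mono fun n h => h.1⟩
      exact tendsto_of_tendsto_of_tendsto_of_le_of_le' tendsto_const_nhds hδ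
        (hev.mono fun n h => h.1) (hev.mono fun n h => h.2)
    have hcont : Tendsto (fun t : ℝ≥0 => Real.exp (-β * t) * f (M.X t ω)) (𝓝[Set.Ici s] s)
        (𝓝 (Real.exp (-β * s) * f (M.X s ω))) := by
      refine Tendsto.mul ?_ ?_
      · have : Continuous fun t : ℝ≥0 => Real.exp (-β * t) := by fun_prop
        exact this.continuousWithinAt
      · exact (continuous_of_discreteTopology (f := f)).continuousAt.tendsto.comp
          (M.right_continuous ω s)
    have := hcont.comp ht
    simpa [Function.comp_def] using this

lemma measurable_discounted {β : ℝ} (hβ : 0 < β) (f : E → ℝ) {σ : Ω → WithTop ℝ≥0}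
    (hσ : IsStoppingTime M.filtration σ) : Measurable (M.discounted β f σ) :=
  measurable_of_tendsto_metrizable (fun _ => M.measurable_gridStopped β f _ hσ _)
    (tendsto_pi_nhds.2 fun ω => M.tendsto_gridStopped hβ f σ ω)

lemma integrable_discounted {β : ℝ} (hβ : 0 < β) (f : E → ℝ) {σ : Ω → WithTop ℝ≥0}
    (hσ : IsStoppingTime M.filtration σ) (x : E) : Integrable (M.discounted β f σ) (M.P x) := by
  obtain ⟨C, hC0, hC⟩ := exists_abs_le f
  exact Integrable.of_bound (M.measurable_discounted hβ f hσ).aestronglyMeasurable C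
    (ae_of_all _ fun ω => M.abs_discounted_le hβ.le hC0 hC σ ω)

/-- If `(𝒬 - β) f` is nonnegative along the path up to the stopping time `σ`, then the discounted
process stopped at `σ` is a submartingale. -/
lemma le_integral_discounted {β : ℝ} (hβ : 0 < β) (f : E → ℝ) {σ : Ω → WithTop ℝ≥0}
    (hσ : IsStoppingTime M.filtration σ)
    (h : ∀ ω (s : ℝ≥0), (s : WithTop ℝ≥0) < σ ω → 0 ≤ discountedGenerator Q β f (M.X s ω))
    (x : E) : f x ≤ ∫ ω, M.discounted β f σ ω ∂(M.P x) := by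
  obtain ⟨C, hC0, hC⟩ := exists_abs_le f
  have hlim : Tendsto (fun n : ℕ => ∫ ω, M.gridStopped β f ((n : ℝ≥0) + 1)⁻¹ σ ((n + 1) ^ 2) ω
      ∂(M.P x)) atTop (𝓝 (∫ ω, M.discounted β f σ ω ∂(M.P x))) :=
    tendsto_integral_of_dominated_convergence (fun _ => C)
      (fun n => (M.measurable_gridStopped β f _ hσ _).aestronglyMeasurable) (integrable_const C)
      (fun n => ae_of_all _ fun ω => M.abs_gridStopped_le hβ.le hC _ σ _ ω)
      (ae_of_all _ fun ω => M.tendsto_gridStopped hβ f σ ω)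
  refine le_of_forall_pos_sub_le fun η hη => ?_
  -- The discounted errors add up to at most `δ * ε / (1 - exp (-β * δ))`, which for `δ ≤ 1` is at
  -- most `ε * (1 + β) / β = η`.
  set ε : ℝ := η * β / (1 + β) with hε
  have hεpos : 0 < ε := by positivity
  obtain ⟨δ₀, hδ₀, hδ⟩ := M.exists_semigroup_lower_bound β f hεpos
  refine ge_of_tendsto hlim ?_
  have hsmall := (tendsto_one_div_add_atTop_nhds_zero_nat (𝕜 := ℝ)).eventually (gt_mem_nhds hδ₀)
  filter_upwards [hsmall] with n hn
  set δ : ℝ≥0 := ((n : ℝ≥0) + 1)⁻¹ with hδdef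
  have hδr : (δ : ℝ) = 1 / ((n : ℝ) + 1) := by simp [hδdef]
  have hδpos : (0 : ℝ) < δ := by rw [hδr]; positivity
  have hδ1 : (δ : ℝ) ≤ 1 := by
    rw [hδr, div_le_one (by positivity)]
    have : (0 : ℝ) ≤ n := n.cast_nonneg
    linarith
  have h1 := M.le_integral_gridStopped β f δ hσ x (a := -(δ * ε)) (fun ω s hs => by
    refine le_trans ?_ (hδ δ (by rw [hδr]; exact hn) (M.X s ω))
    nlinarith [h ω s hs, hδpos]) ((n + 1) ^ 2)
  refine le_trans ?_ h1
  have h2 : -(δ * ε) * ∑ k ∈ Finset.range ((n + 1) ^ 2), Real.exp (-β * δ) ^ k ≤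
      ∑ k ∈ Finset.range ((n + 1) ^ 2), Real.exp (-β * (k * δ)) *
        (-(δ * ε) * (M.P x).real {ω | (((k : ℝ≥0) * δ : ℝ≥0) : WithTop ℝ≥0) < σ ω}) := by
    rw [Finset.mul_sum]
    refine Finset.sum_le_sum fun k _ => ?_
    rw [← Real.exp_nat_mul, mul_comm, show (k : ℝ) * (-β * δ) = -β * (k * δ) by ring]
    refine mul_le_mul_of_nonneg_left ?_ (Real.exp_pos _).le
    have hp : (M.P x).real {ω | (((k : ℝ≥0) * δ : ℝ≥0) : WithTop ℝ≥0) < σ ω} ≤ 1 :=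
      measureReal_le_one
    nlinarith [mul_pos hδpos hεpos]
  have h3 : δ * ε * ∑ k ∈ Finset.range ((n + 1) ^ 2), Real.exp (-β * δ) ^ k ≤ η := by
    set r := Real.exp (-β * δ) with hr
    set S := ∑ k ∈ Finset.range ((n + 1) ^ 2), r ^ k with hS
    have hr0 : 0 < r := Real.exp_pos _
    have hS0 : 0 ≤ S := Finset.sum_nonneg fun k _ => pow_nonneg hr0.le k
    have hgeom : (1 - r) * S ≤ 1 := by
      rw [hS, mul_neg_geom_sum]
      linarith [pow_pos hr0 ((n + 1) ^ 2)]
    have hβδ : β * δ ≤ (1 + β) * (1 - r) := by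
      have hexp : r * (1 + β * δ) ≤ 1 := by
        have h4 := Real.add_one_le_exp (β * δ)
        have h5 : r * Real.exp (β * δ) = 1 := by
          rw [hr, ← Real.exp_add]; simp
        nlinarith
      have hr1 : r ≤ 1 := Real.exp_le_one_iff.2 (by nlinarith)
      have h6 : β * δ ≤ (1 + β * δ) * (1 - r) := by linarith
      have h7 : (1 + β * δ) * (1 - r) ≤ (1 + β) * (1 - r) := by
        refine mul_le_mul_of_nonneg_right ?_ (by linarith)
        nlinarith
      linarith
    have h8 : δ * ε * S = η / (1 + β) * (β * δ * S) := by
      rw [hε]; field_simp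
    rw [h8]
    calc η / (1 + β) * (β * δ * S) ≤ η / (1 + β) * ((1 + β) * (1 - r) * S) := by gcongr
      _ = η * ((1 - r) * S) := by field_simp
      _ ≤ η := by nlinarith
  linarith

lemma discounted_neg (β : ℝ) (f : E → ℝ) (τ : Ω → WithTop ℝ≥0) (ω : Ω) :
    M.discounted β (fun y => -f y) τ ω = -M.discounted β f τ ω := by
  unfold discounted
  split_ifs <;> simp

lemma integral_discounted_le {β : ℝ} (hβ : 0 < β) (f : E → ℝ) {σ : Ω → WithTop ℝ≥0}
    (hσ : IsStoppingTime M.filtration σ)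
    (h : ∀ ω (s : ℝ≥0), (s : WithTop ℝ≥0) < σ ω → discountedGenerator Q β f (M.X s ω) ≤ 0)
    (x : E) : ∫ ω, M.discounted β f σ ω ∂(M.P x) ≤ f x := by
  have := M.le_integral_discounted hβ (fun y => -f y) hσ (fun ω s hs => by
    rw [discountedGenerator_neg]
    linarith [h ω s hs]) x
  simp only [discounted_neg, integral_neg] at this
  linarith

lemma discounted_mono {β : ℝ} {f g : E → ℝ} (hfg : ∀ x, f x ≤ g x) (τ : Ω → WithTop ℝ≥0) (ω : Ω) :
    M.discounted β f τ ω ≤ M.discounted β g τ ω := by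
  unfold discounted
  split_ifs
  · exact le_rfl
  · exact mul_le_mul_of_nonneg_left (hfg _) (Real.exp_pos _).le

/-! ### Hitting times. -/

section HittingTime

variable (A : Set E)

lemma X_notMem_of_lt_h {ω : Ω} {s : ℝ≥0} (hs : (s : WithTop ℝ≥0) < M.h A ω) : M.X s ω ∉ A :=
  notMem_of_lt_hittingAfter hs zero_le

/-- The infimum is attained: right continuity into a discrete space keeps the path outside `A` on
some `[t, u)` if it is outside at `t`, which would delay the hit to `u`. -/
lemma X_mem_of_h_eq {ω : Ω} {t : ℝ≥0} (ht : M.h A ω = t) : M.X t ω ∈ A := by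
  by_contra hA
  have hev : ∀ᶠ s in 𝓝[≥] t, M.X s ω ∉ A :=
    (M.right_continuous ω t).eventually (p := fun y => y ∉ A)
      ((isOpen_discrete Aᶜ).mem_nhds hA)
  obtain ⟨u, hu, hsub⟩ := (mem_nhdsGE_iff_exists_Ico_subset).1 hev
  have hlt : M.h A ω < (u : WithTop ℝ≥0) := by
    rw [ht]
    exact WithTop.coe_lt_coe.2 hu
  obtain ⟨j, hj, hjA⟩ := hittingAfter_lt_iff.1 hlt
  have htj : t ≤ j := by
    have : M.h A ω ≤ j := hittingAfter_le_of_mem hj.1 hjA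
    rw [ht] at this
    exact WithTop.coe_le_coe.1 this
  exact hsub ⟨htj, hj.2⟩ hjA

lemma h_le_iff {ω : Ω} {t : ℝ≥0} : M.h A ω ≤ t ↔ ∃ s ≤ t, M.X s ω ∈ A := by
  constructor
  · intro h
    obtain ⟨s, hs⟩ := WithTop.ne_top_iff_exists.1 (ne_top_of_le_ne_top WithTop.coe_ne_top h)
    exact ⟨s, WithTop.coe_le_coe.1 (hs.trans_le h), M.X_mem_of_h_eq A hs.symm⟩
  · rintro ⟨s, hst, hs⟩
    exact (hittingAfter_le_of_mem zero_le hs).trans (WithTop.coe_le_coe.2 hst)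

/-- A visit to `A` before `t` lasts for a short interval, hence is seen at a time of a countable
dense set. Only a visit at `t` itself must be added, so the raw natural filtration suffices. -/
lemma isStoppingTime_h : IsStoppingTime M.filtration (M.h A) := by
  intro t
  obtain ⟨D, hDc, hD⟩ := TopologicalSpace.exists_countable_dense ℝ≥0
  have heq : {ω | M.h A ω ≤ t} = M.X t ⁻¹' A ∪ ⋃ s ∈ D ∩ Set.Iic t, M.X s ⁻¹' A := by
    ext ω
    simp only [Set.mem_ofPred_eq, h_le_iff, Set.mem_union, Set.mem_preimage, Set.mem_iUnion,
      exists_prop]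
    constructor
    · rintro ⟨s, hst, hs⟩
      rcases hst.eq_or_lt with rfl | hst
      · exact Or.inl hs
      · right
        have hev : ∀ᶠ r in 𝓝[≥] s, M.X r ω ∈ A :=
          (M.right_continuous ω s).eventually (p := fun y => y ∈ A)
            ((isOpen_discrete A).mem_nhds hs)
        obtain ⟨u, hu, hsub⟩ := (mem_nhdsGE_iff_exists_Ico_subset).1 hev
        obtain ⟨r, hrD, hr⟩ := hD.exists_between (lt_min hu hst)
        exact ⟨r, ⟨hrD, (hr.2.trans_le (min_le_right _ _)).le⟩,
          hsub ⟨hr.1.le, hr.2.trans_le (min_le_left _ _)⟩⟩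
    · rintro (h | ⟨s, hs, h⟩)
      · exact ⟨t, le_rfl, h⟩
      · exact ⟨s, hs.2, h⟩
  have hA : MeasurableSet A := (Set.toFinite A).measurableSet
  rw [heq]
  refine (M.measurable_X_filtration le_rfl hA).union ?_
  exact MeasurableSet.biUnion (hDc.mono Set.inter_subset_left) fun s hs =>
    M.measurable_X_filtration hs.2 hA

end HittingTime

/-! ### Verification inequalities and the one-player problem. -/

lemma integrable_payoff {β : ℝ} (hβ : 0 < β) (ψ φ : E → ℝ) {τ γ : Ω → WithTop ℝ≥0}
    (hτ : IsStoppingTime M.filtration τ) (hγ : IsStoppingTime M.filtration γ) (x : E) :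
    Integrable (fun ω => if τ ω ≤ γ ω then M.discounted β ψ τ ω else M.discounted β φ γ ω)
      (M.P x) := by
  obtain ⟨C, hC0, hC⟩ := exists_abs_le ψ
  obtain ⟨D, hD0, hD⟩ := exists_abs_le φ
  have hm : MeasurableSet {ω | τ ω ≤ γ ω} :=
    hτ.measurableSpace_le _ (hτ.measurableSet_le_stopping_time hγ)
  refine Integrable.of_bound (Measurable.ite hm (M.measurable_discounted hβ ψ hτ)
    (M.measurable_discounted hβ φ hγ)).aestronglyMeasurable (max C D) (ae_of_all _ fun ω => ?_)
  split_ifs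
  · exact (M.abs_discounted_le hβ.le hC0 hC τ ω).trans (le_max_left _ _)
  · exact (M.abs_discounted_le hβ.le hD0 hD γ ω).trans (le_max_right _ _)

/-- Before `γ` the chain stays off `{V = φ}`, so discounted `V` decreases in mean up to `τ ∧ γ`.
There it dominates the payoff: `V ≥ ψ` if `τ ≤ γ`, while `γ < τ` forces `γ` finite and `V = φ` at
`γ`. -/
lemma payoff_le_of_supersolution {β : ℝ} (hβ : 0 < β) {ψ φ V : E → ℝ} (hψV : ∀ x, ψ x ≤ V x)
    (hV : ∀ x, V x ≠ φ x → discountedGenerator Q β V x ≤ 0) (x : E) {τ : Ω → WithTop ℝ≥0}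
    (hτ : IsStoppingTime M.filtration τ) :
    M.payoff β ψ φ x τ (M.h {y | V y = φ y}) ≤ V x := by
  set γ := M.h {y | V y = φ y} with hγdef
  have hγ : IsStoppingTime M.filtration γ := M.isStoppingTime_h _
  have hσ := hτ.min hγ
  refine le_trans ?_ (M.integral_discounted_le hβ V hσ (fun ω s hs => ?_) x)
  · refine integral_mono (M.integrable_payoff hβ ψ φ hτ hγ x)
      (M.integrable_discounted hβ V hσ x) fun ω => ?_
    show ite _ _ _ ≤ _
    split_ifs with h
    · exact (M.discounted_mono hψV τ ω).trans_eq
        (M.discounted_congr_time β V (min_eq_left h).symm)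
    · obtain ⟨t, ht⟩ := WithTop.ne_top_iff_exists.1 (not_le.1 h).ne_top
      have hmem : V (M.X t ω) = φ (M.X t ω) := M.X_mem_of_h_eq {y | V y = φ y} ht.symm
      rw [M.discounted_of_eq_coe β φ ht.symm, M.discounted_of_eq_coe β V
        ((min_eq_right (not_le.1 h).le).trans ht.symm), hmem]
  · exact hV _ (M.X_notMem_of_lt_h _ (hs.trans_le (min_le_right _ _)))

lemma le_payoff_of_subsolution {β : ℝ} (hβ : 0 < β) {ψ φ V : E → ℝ} (hVφ : ∀ x, V x ≤ φ x)
    (hV : ∀ x, V x ≠ ψ x → 0 ≤ discountedGenerator Q β V x) (x : E) {γ : Ω → WithTop ℝ≥0}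
    (hγ : IsStoppingTime M.filtration γ) :
    V x ≤ M.payoff β ψ φ x (M.h {y | V y = ψ y}) γ := by
  set τ := M.h {y | V y = ψ y} with hτdef
  have hτ : IsStoppingTime M.filtration τ := M.isStoppingTime_h _
  have hσ := hτ.min hγ
  refine (M.le_integral_discounted hβ V hσ (fun ω s hs => ?_) x).trans ?_
  · exact hV _ (M.X_notMem_of_lt_h _ (hs.trans_le (min_le_left _ _)))
  · refine integral_mono (M.integrable_discounted hβ V hσ x)
      (M.integrable_payoff hβ ψ φ hτ hγ x) fun ω => ?_
    show _ ≤ ite _ _ _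
    split_ifs with h
    · rw [M.discounted_congr_time β V (min_eq_left h)]
      rcases ht : τ ω with _ | t
      · rw [M.discounted_of_eq_top β V ht, M.discounted_of_eq_top β ψ ht]
      · have hmem : V (M.X t ω) = ψ (M.X t ω) := M.X_mem_of_h_eq {y | V y = ψ y} ht
        rw [M.discounted_of_eq_coe β ψ ht, M.discounted_of_eq_coe β V ht, hmem]
    · rw [M.discounted_congr_time β V (min_eq_right (not_le.1 h).le)]
      exact M.discounted_mono hVφ γ ω

lemma measure_h_lt_top_eq_one {β : ℝ} (hβ : 0 < β) {ψ V : E → ℝ} (hψ : ∀ x, 0 ≤ ψ x)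
    (hψV : ∀ x, ψ x ≤ V x) (hV : ∀ x, V x ≠ ψ x → 0 ≤ discountedGenerator Q β V x) (x : E) :
    M.P x {ω | M.h {y | V y = ψ y} ω < ⊤} = 1 := by
  -- The set `{V ≠ ψ}` may be empty, so `m` is taken as a sufficiently small positive number instead
  -- of a minimum.
  obtain ⟨m, hm0, hm⟩ : ∃ m : ℝ, 0 < m ∧ ∀ y, V y ≠ ψ y → m ≤ V y := by
    have hev : ∀ y, ∀ᶠ m : ℝ in 𝓝[>] 0, V y ≠ ψ y → m ≤ V y := by
      intro y
      by_cases hy : V y = ψ y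
      · simp [hy]
      · have hpos : 0 < V y := (hψ y).trans_lt (lt_of_le_of_ne (hψV y) (Ne.symm hy))
        filter_upwards [mem_nhdsWithin_of_mem_nhds (Iic_mem_nhds hpos)] with m hm _ using hm
    obtain ⟨m, hm, hm0⟩ := ((eventually_all.2 hev).and self_mem_nhdsWithin).exists
    exact ⟨m, hm0, hm⟩
  refine M.measure_lt_top_eq_one (M.isStoppingTime_h _) V (mul_pos hβ hm0) (fun ω s hs => ?_) x
  have hne : V (M.X s ω) ≠ ψ (M.X s ω) := M.X_notMem_of_lt_h _ hs
  have h1 := hV _ hne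
  have h2 := mul_le_mul_of_nonneg_left (hm _ hne) hβ.le
  unfold discountedGenerator at h1
  linarith

/-- The fixed point `W` equals `V₀`: it bounds every reward, being a supersolution above `ψ`, and is
achieved by hitting `{W = ψ}`. -/
lemma V₀_obstacle {β : ℝ} (hβ : 0 < β) (ψ : E → ℝ) :
    (∀ x, ψ x ≤ M.V₀ β ψ x) ∧
      ∀ x, M.V₀ β ψ x ≠ ψ x → 0 ≤ discountedGenerator Q β (M.V₀ β ψ) x := by
  obtain ⟨W, a, ha, hW⟩ := exists_obstacle_solution M.isMarkovGenerator hβ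
    (fun x u => max (ψ x) u) fun x u v => by
      simpa only [max_comm (ψ x)] using abs_max_sub_max_le_abs u v (ψ x)
  have hψW : ∀ x, ψ x ≤ W x := fun x => by rw [hW x]; exact le_max_left _ _
  have hsuper : ∀ x, discountedGenerator Q β W x ≤ 0 := fun x => by
    have h1 : W x + a * discountedGenerator Q β W x ≤ W x := by
      conv_rhs => rw [hW x]
      exact le_max_right _ _
    nlinarith
  have hsub : ∀ x, W x ≠ ψ x → 0 ≤ discountedGenerator Q β W x := fun x hx => by
    rcases max_choice (ψ x) (W x + a * discountedGenerator Q β W x) with h | h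
    · exact absurd ((hW x).trans h) hx
    · have := (hW x).trans h
      nlinarith
  have hle : ∀ x (τ : M.StoppingTime), ∫ ω, M.discounted β ψ τ.1 ω ∂(M.P x) ≤ W x :=
    fun x τ => (integral_mono (M.integrable_discounted hβ ψ τ.2 x)
      (M.integrable_discounted hβ W τ.2 x) fun ω => M.discounted_mono hψW τ.1 ω).trans
      (M.integral_discounted_le hβ W τ.2 (fun _ _ _ => hsuper _) x)
  have hV : M.V₀ β ψ = W := by
    funext x
    have : Nonempty M.StoppingTime := ⟨⟨_, M.isStoppingTime_h ∅⟩⟩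
    refine le_antisymm (ciSup_le (hle x)) ?_
    refine le_trans ?_ (le_ciSup (f := fun τ : M.StoppingTime =>
      ∫ ω, M.discounted β ψ τ.1 ω ∂(M.P x)) ⟨W x, Set.forall_mem_range.2 (hle x)⟩
      ⟨_, M.isStoppingTime_h {y | W y = ψ y}⟩)
    refine (M.le_integral_discounted hβ W (M.isStoppingTime_h {y | W y = ψ y})
      (fun ω s hs => hsub _ (M.X_notMem_of_lt_h _ hs)) x).trans_eq ?_
    refine integral_congr_ae (ae_of_all _ fun ω => ?_)
    simp only
    rcases ht : M.h {y | W y = ψ y} ω with _ | t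
    · rw [M.discounted_of_eq_top β W ht, M.discounted_of_eq_top β ψ ht]
    · have hmem : W (M.X t ω) = ψ (M.X t ω) := M.X_mem_of_h_eq {y | W y = ψ y} ht
      rw [M.discounted_of_eq_coe β ψ ht, M.discounted_of_eq_coe β W ht, hmem]
  rw [hV]
  exact ⟨hψW, hsub⟩

/-! ### From a saddle point to the value. -/

/-- Provides the boundedness that real-valued `⨆` and `⨅` need to be genuine suprema and infima. -/
lemma abs_payoff_le {β : ℝ} (hβ : 0 < β) (ψ φ : E → ℝ) :
    ∃ C, ∀ x (τ γ : Ω → WithTop ℝ≥0), |M.payoff β ψ φ x τ γ| ≤ C := by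
  obtain ⟨C, hC0, hC⟩ := exists_abs_le ψ
  obtain ⟨D, hD0, hD⟩ := exists_abs_le φ
  refine ⟨max C D, fun x τ γ => ?_⟩
  have := norm_integral_le_of_norm_le_const (μ := M.P x) (C := max C D)
    (f := fun ω => if τ ω ≤ γ ω then M.discounted β ψ τ ω else M.discounted β φ γ ω)
    (ae_of_all _ fun ω => by
      split_ifs
      · exact (M.abs_discounted_le hβ.le hC0 hC τ ω).trans (le_max_left _ _)
      · exact (M.abs_discounted_le hβ.le hD0 hD γ ω).trans (le_max_right _ _))
  simpa [payoff] using this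

/-- A saddle point whose payoff is `V` shows that `V` is the value of the game. -/
lemma isValue_of_saddle {β : ℝ} (hβ : 0 < β) {ψ φ V : E → ℝ} (τ' γ' : M.StoppingTime)
    (hle : ∀ x (τ : M.StoppingTime), M.payoff β ψ φ x τ.1 γ'.1 ≤ V x)
    (hge : ∀ x (γ : M.StoppingTime), V x ≤ M.payoff β ψ φ x τ'.1 γ.1) :
    M.IsValue β ψ φ V := by
  obtain ⟨C, hC⟩ := M.abs_payoff_le hβ ψ φ
  have : Nonempty M.StoppingTime := ⟨τ'⟩
  intro x
  have hb : ∀ τ : M.StoppingTime,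
      BddBelow (Set.range fun γ : M.StoppingTime => M.payoff β ψ φ x τ.1 γ.1) := fun τ =>
    ⟨-C, Set.forall_mem_range.2 fun γ => (abs_le.1 (hC x τ.1 γ.1)).1⟩
  have ha : ∀ γ : M.StoppingTime,
      BddAbove (Set.range fun τ : M.StoppingTime => M.payoff β ψ φ x τ.1 γ.1) := fun γ =>
    ⟨C, Set.forall_mem_range.2 fun τ => (abs_le.1 (hC x τ.1 γ.1)).2⟩
  have hlow : ∀ τ : M.StoppingTime, ⨅ γ : M.StoppingTime, M.payoff β ψ φ x τ.1 γ.1 ≤ V x :=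
    fun τ => (ciInf_le (hb τ) γ').trans (hle x τ)
  have hupp : ∀ γ : M.StoppingTime, V x ≤ ⨆ τ : M.StoppingTime, M.payoff β ψ φ x τ.1 γ.1 :=
    fun γ => (hge x γ).trans (le_ciSup (ha γ) τ')
  refine ⟨le_antisymm (ciSup_le hlow) ?_, le_antisymm ?_ (le_ciInf hupp)⟩
  · exact (le_ciInf (hge x)).trans (le_ciSup
      (f := fun τ : M.StoppingTime => ⨅ γ : M.StoppingTime, M.payoff β ψ φ x τ.1 γ.1)
      ⟨V x, Set.forall_mem_range.2 hlow⟩ τ')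
  · exact (ciInf_le (f := fun γ : M.StoppingTime =>
      ⨆ τ : M.StoppingTime, M.payoff β ψ φ x τ.1 γ.1)
      ⟨V x, Set.forall_mem_range.2 hupp⟩ γ').trans (ciSup_le (hle x))

end MarkovChain
end StoppingGame

theorem theorem3p2 {Ω E : Type*} [MeasurableSpace Ω] [Fintype E] [TopologicalSpace E]
    [DiscreteTopology E] [MeasurableSpace E] [BorelSpace E] {Q : Matrix E E ℝ}
    (M : StoppingGame.MarkovChain Ω E Q) (β : ℝ) (hβ : 0 < β) (ψ φ : E → ℝ)
    (hψ : ∀ x, 0 ≤ ψ x) (hψφ : ∀ x, ψ x ≤ φ x) :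
    (∀ x, M.P x {ω | M.h {y | M.V₀ β ψ y = ψ y} ω < ⊤} = 1) ∧
    ∃ V : E → ℝ, M.IsValue β ψ φ V ∧
      M.IsNash β ψ φ (M.h {y | V y = ψ y}) (M.h {y | V y = φ y}) ∧
      (∀ x, M.P x {ω | M.h {y | V y = ψ y} ω < ⊤} = 1) ∧
      (∀ x, M.P x {ω | min (M.h {y | V y = ψ y} ω) (M.h {y | V y = φ y} ω) < ⊤} = 1) := by
  obtain ⟨hψV₀, hV₀⟩ := M.V₀_obstacle hβ ψ
  refine ⟨M.measure_h_lt_top_eq_one hβ hψ hψV₀ hV₀, ?_⟩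
  obtain ⟨V, a, ha, hV⟩ := StoppingGame.exists_obstacle_solution M.isMarkovGenerator hβ
    -- Truncation to `[ψ x, φ x]`, which is 1-Lipschitz in `u`.
    (fun x u => max (min u (φ x)) (ψ x)) fun x u v =>
      (abs_max_sub_max_le_abs _ _ _).trans
        ((abs_min_sub_min_le_max u (φ x) v (φ x)).trans (by simp))
  have hψV : ∀ x, ψ x ≤ V x := fun x => by rw [hV x]; exact le_max_right _ _
  have hVφ : ∀ x, V x ≤ φ x := fun x => by
    rw [hV x]; exact max_le (min_le_right _ _) (hψφ x)
  have hsuper : ∀ x, V x ≠ φ x → StoppingGame.discountedGenerator Q β V x ≤ 0 := by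
    intro x hx
    have h1 : min (V x + a * StoppingGame.discountedGenerator Q β V x) (φ x) ≤ V x := by
      conv_rhs => rw [hV x]
      exact le_max_left _ _
    -- Where `V < φ` the upper obstacle is inactive, so the bound falls on `V + a (𝒬 - β) V`, and `a
    -- > 0` gives the sign.
    have h2 := (min_le_iff.1 h1).resolve_right (not_le.2 (lt_of_le_of_ne (hVφ x) hx))
    nlinarith
  have hsub : ∀ x, V x ≠ ψ x → 0 ≤ StoppingGame.discountedGenerator Q β V x := by
    intro x hx
    have h1 : V x ≤ max (min (V x + a * StoppingGame.discountedGenerator Q β V x) (φ x)) (ψ x) :=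
      (hV x).le
    have h2 := (le_max_iff.1 h1).resolve_right
      (not_le.2 (lt_of_le_of_ne (hψV x) (Ne.symm hx)))
    have h3 := h2.trans (min_le_left _ _)
    nlinarith
  have hτ' := M.isStoppingTime_h {y | V y = ψ y}
  have hγ' := M.isStoppingTime_h {y | V y = φ y}
  have hle := fun x (τ : M.StoppingTime) => M.payoff_le_of_supersolution hβ hψV hsuper x τ.2
  have hge := fun x (γ : M.StoppingTime) => M.le_payoff_of_subsolution hβ hVφ hsub x γ.2
  have hfin := M.measure_h_lt_top_eq_one hβ hψ hψV hsub
  refine ⟨V, M.isValue_of_saddle hβ ⟨_, hτ'⟩ ⟨_, hγ'⟩ hle hge, ⟨hτ', hγ', fun x τ => ?_,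
    fun x γ => ?_⟩, hfin, fun x => ?_⟩
  · exact (hle x τ).trans (hge x ⟨_, hγ'⟩)
  · exact (hle x ⟨_, hτ'⟩).trans (hge x γ)
  · exact le_antisymm prob_le_one ((hfin x).symm.le.trans
      (measure_mono fun ω hω => lt_of_le_of_lt (b := M.h {y | V y = ψ y} ω) (min_le_left _ _) hω))
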